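/- For $n\ge 1$, call a binary string of length $n$ run-constrained-circularly if, when the string is read in a circular manner, every run (maximal block) of 1s is immediately followed by a strictly longer run of 0s (in particular the all-0 string qualifies and the all-1 string does not). The associated Mersenne graph $\mathcal{M}_n$ has the run-constrained-circularly strings of length $n$ as its vertices, two of them being adjacent if and only if their Hamming distance is $1$. Let $|E(\mathcal{M}_n)|$ be its number of edges. Then, as an identity of formal power series over $\mathbb{Q}$, $$\sum_{n\ge 3}|E(\mathcal{M}_n)|\,x^n=\frac{(3-2x+4x^2-4x^3-3x^4)\,x^3}{(1-x-x^2)^2}.$$ -/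

import Mathlib

/-- The position reached from position `i` of a circular string of length `n` by moving `j` steps
to the right. -/
def cyclicShift {n : ℕ} (i : Fin n) (j : ℕ) : Fin n :=
  ⟨(i.val + j) % n, Nat.mod_lt _ i.pos⟩

/-- `IsCircularRun b c i r`: read in a circular manner, the binary string `b` of length `n` has a
run of bits equal to `c` that starts at position `i` and has length `r`. That is, the `r`
contiguous positions from `i` on are nonempty, pairwise distinct (`r ≤ n`) and all carry the bit
`c`, and this block is not extendable: it is the whole circle, or the position before it and the
position after it both carry the other bit. -/
def IsCircularRun {n : ℕ} (b : Fin n → Bool) (c : Bool) (i : Fin n) (r : ℕ) : Prop :=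
  1 ≤ r ∧ r ≤ n ∧ (∀ j < r, b (cyclicShift i j) = c) ∧
    (r = n ∨ (b (cyclicShift i (n - 1)) ≠ c ∧ b (cyclicShift i r) ≠ c))

/-- A binary string is run-constrained-circularly if every run of 1s in it is immediately followed
by a strictly longer run of 0s, in a circular manner (`true` is the bit 1, `false` the bit 0). -/
def IsRunConstrainedCircularly {n : ℕ} (b : Fin n → Bool) : Prop :=
  ∀ (i : Fin n) (r : ℕ), IsCircularRun b true i r →
    ∃ s, r < s ∧ IsCircularRun b false (cyclicShift i r) s

/-- The hypercube `Q_n`: binary strings of length `n`, adjacent when their Hamming distance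
is 1. -/
def hypercubeGraph (n : ℕ) : SimpleGraph (Fin n → Bool) where
  Adj u v := hammingDist u v = 1
  symm := ⟨fun u v h => by rw [hammingDist_comm]; exact h⟩
  loopless := ⟨fun u h => by simp at h⟩

/-- The associated Mersenne graph `M_n`: the graph on the run-constrained-circularly strings of
length `n`, two of them being adjacent when their Hamming distance is 1. -/
def associatedMersenneGraph (n : ℕ) :
    SimpleGraph {b : Fin n → Bool | IsRunConstrainedCircularly b} :=
  (hypercubeGraph n).induce {b : Fin n → Bool | IsRunConstrainedCircularly b}

/-! An edge is a valid string together with a 1 that can be cleared without losing validity. By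
rotation invariance it suffices to count such strings at position 0 and multiply by `n`
(`card_isRemovable`). A 1 can be cleared exactly when it starts or ends its run
(`circularly_clear_iff`). Starting and ending are equally frequent, so inclusion-exclusion gives
twice the number of run starts minus the number of isolated 1s.

Cutting the circle at a run start gives a linear concatenation of blocks `1^r 0^s` with `s > r`, and
an automaton counts these by Fibonacci numbers. Hence the number of edges is `n(2F_{n-2} - F_{n-3})
= n(F_{n-4} + F_{n-2})` for `n ≥ 4`. At `n = 3` the isolated count is 1 rather than `F_0`, so that
case is separate. The generating function follows by comparing coefficients. -/

theorem cyclicShift_add {n : ℕ} (i : Fin n) (j k : ℕ) :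
    cyclicShift (cyclicShift i j) k = cyclicShift i (j + k) := by
  apply Fin.ext
  simp [cyclicShift, Nat.add_assoc]

/-- The `n`-periodic extension of a circular string of length `n`. -/
def periodicExt {n : ℕ} [NeZero n] (b : Fin n → Bool) (k : ℕ) : Bool := b (Fin.ofNat n k)

/-- A sequence containing a `0`, in which every block of `r` consecutive 1s that is followed by
a `0` is followed by `r + 1` consecutive 0s. -/
def RunConstrained (p : ℕ → Bool) : Prop :=
  (∃ k, p k = false) ∧
    ∀ i r, (∀ j < r, p (i + j) = true) → p (i + r) = false → ∀ j ≤ r, p (i + r + j) = false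

/-! ### Circular strings as periodic sequences -/

section Periodic

variable {n : ℕ} [NeZero n] (b : Fin n → Bool)

theorem apply_cyclicShift (i : Fin n) (j : ℕ) : b (cyclicShift i j) = periodicExt b (i + j) := rfl

theorem periodicExt_val (i : Fin n) : periodicExt b i = b i := by
  simp [periodicExt]

theorem periodicExt_of_lt {k : ℕ} (hk : k < n) : periodicExt b k = b ⟨k, hk⟩ :=
  periodicExt_val b ⟨k, hk⟩

theorem periodicExt_congr {k l : ℕ} (h : k % n = l % n) : periodicExt b k = periodicExt b l := by
  unfold periodicExt
  congr 1
  exact Fin.ext h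

theorem periodicExt_add_period (k : ℕ) : periodicExt b (k + n) = periodicExt b k :=
  periodicExt_congr b (by simp)

theorem apply_cyclicShift_cyclicShift (i : Fin n) (j k : ℕ) :
    b (cyclicShift (cyclicShift i j) k) = periodicExt b (i + j + k) := by
  rw [cyclicShift_add, apply_cyclicShift b, Nat.add_assoc]

theorem apply_ofNat_cyclicShift (i j : ℕ) :
    b (cyclicShift (Fin.ofNat n i) j) = periodicExt b (i + j) := by
  rw [apply_cyclicShift b]
  exact periodicExt_congr b (by simp [Fin.ofNat])

theorem runConstrained_of_circularly (h : IsRunConstrainedCircularly b) :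
    RunConstrained (periodicExt b) := by
  have hn : 0 < n := Nat.pos_of_ne_zero (NeZero.ne n)
  refine ⟨?_, ?_⟩
  · by_contra! hc
    have hc' : ∀ k, periodicExt b k = true := fun k => by simpa using hc k
    -- The whole circle would be a run of length `n`, demanding a longer run of 0s.
    obtain ⟨s, hs, -, hs', -⟩ := h ⟨0, hn⟩ n
      ⟨hn, le_rfl, fun j _ => by rw [apply_cyclicShift b]; exact hc' _, Or.inl rfl⟩
    omega
  · intro i r hr h0
    rcases Nat.eq_zero_or_pos r with rfl | hr0
    · intro j hj
      obtain rfl : j = 0 := by omega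
      simpa using h0
    -- `e` is the end of the block, moved one period to the right
    set e := i + r + n with he
    have hex : ∃ m, periodicExt b (e - (m + 1)) = false :=
      ⟨n - 1, by rw [show e - (n - 1 + 1) = i + r by omega]; exact h0⟩
    classical
    -- `R` is the length of the maximal run ending where the block ends; since `r ≤ R`, its demand
    -- covers that of the block.
    set R := Nat.find hex with hR
    have hR0 : periodicExt b (e - (R + 1)) = false := Nat.find_spec hex
    have hRn : R ≤ n - 1 :=
      Nat.find_min' hex (by rw [show e - (n - 1 + 1) = i + r by omega]; exact h0)
    have hR1 : ∀ m < R, periodicExt b (e - (m + 1)) = true := fun m hm => by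
      simpa using Nat.find_min hex hm
    have hrR : r ≤ R := by
      by_contra! hlt
      have h1 := hr (r - (R + 1)) (by omega)
      rw [← periodicExt_add_period, show i + (r - (R + 1)) + n = e - (R + 1) by omega] at h1
      simp [h1] at hR0
    obtain ⟨s, hs, -, -, hz, -⟩ := h (Fin.ofNat n (e - R)) R
      ⟨by omega, by omega, fun j hj => by
        rw [apply_ofNat_cyclicShift b, show e - R + j = e - ((R - 1 - j) + 1) by omega]
        exact hR1 _ (by omega), Or.inr ⟨by
          rw [apply_ofNat_cyclicShift b, show e - R + (n - 1) = e - (R + 1) + n by omega,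
            periodicExt_add_period, hR0]
          simp, by
          rw [apply_ofNat_cyclicShift b, show e - R + R = i + r + n by omega,
            periodicExt_add_period, h0]
          simp⟩⟩
    intro j hj
    have := hz j (by omega)
    rw [cyclicShift_add, apply_ofNat_cyclicShift b, show e - R + (R + j) = i + r + j + n by omega,
      periodicExt_add_period] at this
    exact this

theorem circularly_of_runConstrained (h : RunConstrained (periodicExt b)) :
    IsRunConstrainedCircularly b := by
  intro i r ⟨h1, hrn, hones, hmax⟩
  have hones' : ∀ j < r, periodicExt b (i + j) = true := hones
  have hlt : r ≠ n := by
    rintro rfl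
    obtain ⟨k, hk⟩ := h.1
    have h2 := hones' ((k + (r - i)) % r) (Nat.mod_lt _ (by omega))
    rw [periodicExt_congr b (l := k)] at h2
    · simp [h2] at hk
    · rw [Nat.add_mod_mod, show (i : ℕ) + (k + (r - i)) = k + r by omega, Nat.add_mod_right]
  have h0 : periodicExt b (i + r) = false := by
    rcases hmax with h | h
    · exact absurd h hlt
    · simpa [apply_cyclicShift] using h.2
  have hz := h.2 i r hones' h0
  have hper : periodicExt b (i + r + (n - r)) = true := by
    rw [show (i : ℕ) + r + (n - r) = i + n by omega, periodicExt_add_period]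
    simpa using hones' 0 h1
  have hex : ∃ s, periodicExt b (i + r + s) = true := ⟨_, hper⟩
  classical
  have hs1 := Nat.find_spec hex
  have hs2 : ∀ s < Nat.find hex, periodicExt b (i + r + s) = false := fun s hs => by
    simpa using Nat.find_min hex hs
  have hs3 : Nat.find hex ≤ n - r := Nat.find_min' hex hper
  have hs4 : r < Nat.find hex := by
    by_contra! hle
    simp [hz _ hle] at hs1
  refine ⟨Nat.find hex, hs4, by omega, by omega, fun j hj => ?_, Or.inr ⟨?_, ?_⟩⟩
  · rw [apply_cyclicShift_cyclicShift b]
    exact hs2 j hj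
  · rw [apply_cyclicShift_cyclicShift b, show (i : ℕ) + r + (n - 1) = i + (r - 1) + n by omega,
      periodicExt_add_period, hones' _ (by omega)]
    simp
  · rw [apply_cyclicShift_cyclicShift b, hs1]
    simp

theorem isRunConstrainedCircularly_iff :
    IsRunConstrainedCircularly b ↔ RunConstrained (periodicExt b) :=
  ⟨runConstrained_of_circularly b, circularly_of_runConstrained b⟩

/-! ### Rotation invariance -/

/-- Rotation of a circular string by `c` positions. -/
def rotate (c : Fin n) : (Fin n → Bool) ≃ (Fin n → Bool) :=
  (Equiv.addRight c).symm.arrowCongr (Equiv.refl Bool)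

theorem rotate_apply (c i : Fin n) : rotate c b i = b (i + c) := rfl

theorem periodicExt_rotate (c : Fin n) (k : ℕ) :
    periodicExt (rotate c b) k = periodicExt b (k + c) := by
  simp only [periodicExt, rotate_apply]
  congr 1
  apply Fin.ext
  simp [Fin.val_add, Fin.ofNat]

theorem RunConstrained.shift (h : RunConstrained (periodicExt b)) (c : ℕ) :
    RunConstrained fun k => periodicExt b (k + c) := by
  obtain ⟨⟨k, hk⟩, h⟩ := h
  -- Adding `c` to this witness gives `k + n * c`, a whole number of periods past `k`.
  refine ⟨⟨k + c * (n - 1), ?_⟩, fun i r h1 h0 j hj => ?_⟩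
  · beta_reduce
    rw [periodicExt_congr b (l := k), hk]
    have : k + c * (n - 1) + c = k + n * c := by
      have := Nat.pos_of_ne_zero (NeZero.ne n)
      obtain ⟨m, rfl⟩ : ∃ m, n = m + 1 := ⟨n - 1, by omega⟩
      simp; ring
    rw [this, Nat.add_mul_mod_self_left]
  · have := h (i + c) r (fun j hj => by rw [Nat.add_right_comm]; exact h1 j hj)
      (by rw [Nat.add_right_comm]; exact h0) j hj
    rwa [show i + c + r + j = i + r + j + c by ring] at this

theorem IsRunConstrainedCircularly.rotate {b : Fin n → Bool} (h : IsRunConstrainedCircularly b)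
    (c : Fin n) : IsRunConstrainedCircularly (rotate c b) := by
  rw [isRunConstrainedCircularly_iff] at h ⊢
  convert h.shift b c using 2 with k
  exact periodicExt_rotate b c k

theorem isRunConstrainedCircularly_rotate (c : Fin n) :
    IsRunConstrainedCircularly (rotate c b) ↔ IsRunConstrainedCircularly b := by
  refine ⟨fun h => ?_, fun h => h.rotate c⟩
  have := h.rotate (-c)
  convert this using 1
  ext i
  simp [rotate_apply]

/-! ### Clearing a bit -/

theorem periodicExt_clear (k : ℕ) :
    periodicExt (Function.update b 0 false) k = (if k % n = 0 then false else periodicExt b k) := by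
  have : (Fin.ofNat n k = 0) ↔ k % n = 0 := by
    rw [Fin.ext_iff]; simp [Fin.ofNat]
  simp only [periodicExt, Function.update_apply, this]

/-- Clearing an interior 1 of a run leaves 1s followed by a single 0. Clearing an end of a run only
shortens the run and lengthens a neighbouring run of 0s. -/
theorem circularly_clear_iff (hn : 3 ≤ n) {b : Fin n → Bool} (h : IsRunConstrainedCircularly b)
    (hb : b 0 = true) :
    IsRunConstrainedCircularly (Function.update b 0 false) ↔
      (periodicExt b (n - 1) = false ∨ periodicExt b 1 = false) := by
  rw [isRunConstrainedCircularly_iff] at h ⊢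
  have hb0 : ∀ k, k % n = 0 → periodicExt b k = true := fun k hk => by
    rw [periodicExt_congr b (l := 0) (by simpa using hk), ← hb]
    exact periodicExt_of_lt b (by omega)
  constructor
  · intro hc
    by_contra! hcon
    simp only [ne_eq, Bool.not_eq_false] at hcon
    have h1 : (1 : ℕ) % n = 1 := Nat.mod_eq_of_lt (by omega)
    have h2 : (n - 1) % n = n - 1 := Nat.mod_eq_of_lt (by omega)
    have := hc.2 (n - 1) 1 (fun j hj => by
      obtain rfl : j = 0 := by omega
      rw [periodicExt_clear, Nat.add_zero, h2, if_neg (by omega), hcon.1])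
      (by rw [periodicExt_clear, Nat.sub_add_cancel (by omega)]; simp) 1 le_rfl
    rw [Nat.sub_add_cancel (by omega), Nat.add_comm, periodicExt_add_period, periodicExt_clear, h1,
      if_neg one_ne_zero, hcon.2] at this
    simp at this
  · intro hor
    refine ⟨⟨0, by simp [periodicExt_clear]⟩, fun i r h1 h0 j hj => ?_⟩
    have h1' : ∀ j < r, periodicExt b (i + j) = true := fun j hj => by
      have := h1 j hj
      rw [periodicExt_clear] at this
      split_ifs at this
      exact this
    rw [periodicExt_clear]
    by_cases hm : (i + r) % n = 0
    · rcases Nat.eq_zero_or_pos j with rfl | hj0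
      · simp [hm]
      -- The block stops at the cleared bit, which was therefore the last 1 of its run. In `b` the
      -- block has length `r + 1`, and the 0s after it suffice.
      have hpre : periodicExt b (n - 1) = true := by
        rw [← h1' (r - 1) (by omega)]
        apply periodicExt_congr
        obtain ⟨q, hq⟩ := Nat.dvd_of_mod_eq_zero hm
        have hq0 : 1 ≤ q := by
          by_contra! hq0
          obtain rfl : q = 0 := by omega
          omega
        obtain ⟨q, rfl⟩ : ∃ t, q = t + 1 := ⟨q - 1, by omega⟩
        rw [show i + (r - 1) = n - 1 + n * q by rw [Nat.mul_add] at hq; omega,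
          Nat.add_mul_mod_self_left]
      have hnext : periodicExt b (i + (r + 1)) = false := by
        rw [periodicExt_congr b (l := 1)]
        · simpa [hpre] using hor
        · rw [← Nat.add_assoc, Nat.add_mod, hm]; simp
      have := h.2 i (r + 1) (fun j hj => by
        rcases Nat.lt_succ_iff_lt_or_eq.1 hj with hj | rfl
        · exact h1' j hj
        · exact hb0 _ hm) hnext (j - 1) (by omega)
      rw [show i + (r + 1) + (j - 1) = i + r + j by omega] at this
      simp [this]
    · rw [periodicExt_clear, if_neg hm] at h0
      simp [h.2 i r h1' h0 j hj]

end Periodic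

/-! ### Counting block concatenations -/

/-- Recognizer for concatenations of blocks `1^r 0^s` with `s > r ≥ 1`, possibly preceded by 0s.
In the state `(false, d)` at least `d` further 0s are required; in the state `(true, r)` a run of
`r` 1s has just been read. -/
def acceptsBlocks : Bool → ℕ → List Bool → Bool
  | false, d, [] => d == 0
  | true, _, [] => false
  | false, d, false :: l => acceptsBlocks false (d - 1) l
  | false, d, true :: l => d == 0 && acceptsBlocks true 1 l
  | true, r, false :: l => acceptsBlocks false r l
  | true, r, true :: l => acceptsBlocks true (r + 1) l

/-- The strings of length `n` accepted from a given state. -/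
def acceptedCount (c : Bool) (d n : ℕ) : ℕ :=
  ∑ b : Fin n → Bool, if acceptsBlocks c d (List.ofFn b) then 1 else 0

theorem sum_string_succ {n : ℕ} (f : (Fin (n + 1) → Bool) → ℕ) :
    ∑ b, f b = ∑ b : Fin n → Bool, f (Fin.cons true b) + ∑ b : Fin n → Bool, f (Fin.cons false b) := by
  rw [← (Fin.consEquiv fun _ => Bool).sum_comp, Fintype.sum_prod_type, Fintype.sum_bool]
  rfl

theorem acceptedCount_false_zero (d : ℕ) : acceptedCount false d 0 = if d = 0 then 1 else 0 := by
  simp [acceptedCount, acceptsBlocks]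

theorem acceptedCount_true_zero (r : ℕ) : acceptedCount true r 0 = 0 := by
  simp [acceptedCount, acceptsBlocks]

theorem acceptedCount_false_succ (d n : ℕ) :
    acceptedCount false (d + 1) (n + 1) = acceptedCount false d n := by
  rw [acceptedCount, sum_string_succ]
  simp [acceptsBlocks, acceptedCount]

theorem acceptedCount_false_zero_succ (n : ℕ) :
    acceptedCount false 0 (n + 1) = acceptedCount true 1 n + acceptedCount false 0 n := by
  rw [acceptedCount, sum_string_succ]
  simp [acceptsBlocks, acceptedCount]

theorem acceptedCount_true_succ (r n : ℕ) :
    acceptedCount true r (n + 1) = acceptedCount true (r + 1) n + acceptedCount false r n := by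
  rw [acceptedCount, sum_string_succ]
  simp [acceptsBlocks, acceptedCount]

/-- Behind the equality: deleting one of the 0s demanded by the pending run matches the two sets of
continuations. -/
theorem acceptedCount_true_succ_succ (r n : ℕ) :
    acceptedCount true (r + 1) (n + 1) = acceptedCount true r n := by
  induction n generalizing r with
  | zero => simp [acceptedCount_true_succ, acceptedCount_true_zero, acceptedCount_false_zero]
  | succ n ih => rw [acceptedCount_true_succ, ih, acceptedCount_false_succ, ← acceptedCount_true_succ]

theorem acceptedCount_true_one (n : ℕ) :
    acceptedCount true 1 (n + 2) = acceptedCount false 0 (n + 1) := by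
  rw [acceptedCount_true_succ, acceptedCount_true_succ_succ, acceptedCount_false_succ,
    acceptedCount_false_zero_succ]

/-- The index shift matters: the empty string is accepted, so the count at length 0 is 1, not
`Nat.fib 0`. -/
theorem acceptedCount_eq_fib (n : ℕ) : acceptedCount false 0 (n + 1) = Nat.fib (n + 1) := by
  induction n using Nat.strong_induction_on with
  | _ n ih =>
    match n with
    | 0 => simp [acceptedCount_false_zero_succ, acceptedCount_true_zero, acceptedCount_false_zero]
    | 1 => simp [acceptedCount_false_zero_succ, acceptedCount_true_zero, acceptedCount_false_zero,
        acceptedCount_true_succ]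
    | k + 2 =>
      rw [acceptedCount_false_zero_succ, acceptedCount_true_one, ih k (by omega),
        ih (k + 1) (by omega), ← Nat.fib_add_two]

/-! ### Correctness of the recognizer -/

/-- Every block of 1s not continued by a further 1 is followed, inside the list, by strictly more
0s. -/
def BlockConstrained (l : List Bool) : Prop :=
  ∀ i r, 1 ≤ r → (∀ j < r, l[i + j]? = some true) → l[i + r]? ≠ some true →
    ∀ j ≤ r, l[i + r + j]? = some false

theorem blockConstrained_cons_false (l : List Bool) :
    BlockConstrained (false :: l) ↔ BlockConstrained l := by
  constructor
  · intro h i r hr h1 h0 j hj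
    have := h (i + 1) r hr (fun j hj => by
      rw [Nat.add_right_comm, List.getElem?_cons_succ]; exact h1 j hj)
      (by rw [Nat.add_right_comm, List.getElem?_cons_succ]; exact h0) j hj
    rw [show i + 1 + r + j = i + r + j + 1 by ring, List.getElem?_cons_succ] at this
    exact this
  · intro h i r hr h1 h0 j hj
    rcases i with _ | i
    · have := h1 0 hr
      simp at this
    rw [show i + 1 + r + j = i + r + j + 1 by ring, List.getElem?_cons_succ]
    rw [Nat.add_right_comm, List.getElem?_cons_succ] at h0
    refine h i r hr (fun j hj => ?_) h0 j hj
    have := h1 j hj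
    rwa [Nat.add_right_comm, List.getElem?_cons_succ] at this

/-- A block starting inside the leading 1s is a suffix of them and demands no more than the full
run; all other blocks lie past the displayed 0. -/
theorem blockConstrained_replicate_append {r : ℕ} (hr : 1 ≤ r) (l : List Bool) :
    BlockConstrained (List.replicate r true ++ false :: l) ↔
      (∀ j < r, l[j]? = some false) ∧ BlockConstrained l := by
  have hlt : ∀ k < r, (List.replicate r true ++ false :: l)[k]? = some true := fun k hk => by
    rw [List.getElem?_append_left (by simpa using hk)]; simp [hk]
  have hge : ∀ k, (List.replicate r true ++ false :: l)[r + k]? = (false :: l)[k]? := fun k => by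
    rw [List.getElem?_append_right (by simp)]; simp
  rw [← blockConstrained_cons_false l]
  constructor
  · intro h
    refine ⟨fun j hj => ?_, fun i s hs h1 h0 j hj => ?_⟩
    · have := h 0 r hr (fun j hj => by simpa using hlt j hj)
        (by simp) (j + 1) (by omega)
      rwa [Nat.zero_add, hge, List.getElem?_cons_succ] at this
    · have := h (r + i) s hs (fun j hj => by rw [Nat.add_assoc, hge]; exact h1 j hj)
        (by rw [Nat.add_assoc, hge]; exact h0) j hj
      rwa [Nat.add_assoc, Nat.add_assoc, hge, ← Nat.add_assoc] at this
  · rintro ⟨hz, h⟩ i s hs h1 h0 j hj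
    rcases lt_or_ge i r with hi | hi
    · have hle : i + s ≤ r := by
        by_contra! hc
        have h2 := h1 (r - i) (by omega)
        have h3 := hge 0
        rw [show i + (r - i) = r + 0 by omega, h3] at h2
        simp at h2
      have heq : i + s = r := by
        by_contra hne
        exact h0 (hlt _ (by omega))
      rw [heq, hge]
      rcases j with _ | j
      · simp
      · rw [List.getElem?_cons_succ]; exact hz j (by omega)
    · obtain ⟨i, rfl⟩ := Nat.exists_eq_add_of_le hi
      rw [Nat.add_assoc, hge] at h0
      rw [Nat.add_assoc, Nat.add_assoc, hge, ← Nat.add_assoc]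
      refine h i s hs (fun j hj => ?_) h0 j hj
      rw [← hge, ← Nat.add_assoc]
      exact h1 j hj

theorem not_blockConstrained_replicate {r : ℕ} (hr : 1 ≤ r) :
    ¬ BlockConstrained (List.replicate r true) := fun h => by
  have := h 0 r hr (fun j hj => by simp [hj]) (by simp) 0 (by simp)
  simp at this

theorem acceptsBlocks_iff (l : List Bool) :
    (∀ d, acceptsBlocks false d l = true ↔
      (∀ j < d, l[j]? = some false) ∧ BlockConstrained l) ∧
    ∀ r, 1 ≤ r → (acceptsBlocks true r l = true ↔
      BlockConstrained (List.replicate r true ++ l)) := by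
  induction l with
  | nil =>
    refine ⟨fun d => ?_, fun r hr => ?_⟩
    · have h0 : BlockConstrained [] := fun i r hr h1 => by simpa using h1 0 hr
      rcases d with _ | d
      · simp [acceptsBlocks, h0]
      · simp only [acceptsBlocks]
        simpa using fun h => absurd (h 0) (by omega)
    · simp [acceptsBlocks, not_blockConstrained_replicate hr]
  | cons a l ih =>
    cases a
    · refine ⟨fun d => ?_, fun r hr => ?_⟩
      · rw [acceptsBlocks, ih.1, blockConstrained_cons_false]
        refine and_congr_left fun _ => ⟨fun h j hj => ?_, fun h j hj => ?_⟩
        · rcases j with _ | j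
          · simp
          · simpa using h j (by omega)
        · simpa using h (j + 1) (by omega)
      · rw [acceptsBlocks, ih.1, blockConstrained_replicate_append hr]
    · refine ⟨fun d => ?_, fun r hr => ?_⟩
      · rw [acceptsBlocks, Bool.and_eq_true, ih.2 1 le_rfl]
        refine and_congr ?_ Iff.rfl
        rcases d with _ | d
        · simp
        · simpa using ⟨0, by simp⟩
      · rw [acceptsBlocks, ih.2 (r + 1) (by omega), List.replicate_succ', List.append_assoc]
        rfl

/-- With a 1 first and a 0 last, no run crosses the seam, so the circular and linear conditions
agree. -/
theorem runConstrained_periodicExt_iff {n : ℕ} [NeZero n] (b : Fin n → Bool) (hb : b 0 = true) :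
    (RunConstrained (periodicExt b) ∧ periodicExt b (n - 1) = false) ↔
      BlockConstrained (List.ofFn b) := by
  have hn : 0 < n := Nat.pos_of_ne_zero (NeZero.ne n)
  have hb0 : periodicExt b 0 = true := (periodicExt_of_lt b hn).trans hb
  have hbn : periodicExt b n = true := by
    rw [← hb0, periodicExt_congr b]; simp
  have hlt : ∀ k < n, (List.ofFn b)[k]? = some (periodicExt b k) := fun k hk => by
    rw [List.getElem?_ofFn, dif_pos hk, periodicExt_of_lt b hk]
  have hge : ∀ k, n ≤ k → (List.ofFn b)[k]? = none := fun k hk => by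
    rw [List.getElem?_ofFn, dif_neg (by omega)]
  constructor
  · rintro ⟨h, hlast⟩ i r hr h1 h0 j hj
    have hin : ∀ j < r, i + j < n := fun j hj => by
      by_contra! hc
      have := h1 j hj
      simp [hge _ hc] at this
    have h1' : ∀ j < r, periodicExt b (i + j) = true := fun j hj => by
      simpa [hlt _ (hin j hj)] using h1 j hj
    have hlast' : i + (r - 1) ≠ n - 1 := fun he => by
      have := h1' (r - 1) (by omega)
      simp [he, hlast] at this
    have hrn : i + r < n := by
      have := hin (r - 1) (by omega)
      omega
    have hz := h.2 i r h1' (by simpa [hlt _ hrn] using h0)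
    have hjn : i + r + j < n := by
      by_contra! hc
      have := hz (n - (i + r)) (by omega)
      rw [show i + r + (n - (i + r)) = n by omega, hbn] at this
      simp at this
    rw [hlt _ hjn, hz j hj]
  · intro h
    have hlast : periodicExt b (n - 1) = false := by
      by_contra hc
      have := h (n - 1) 1 le_rfl (fun j hj => by
        obtain rfl : j = 0 := by omega
        rw [Nat.add_zero, hlt _ (by omega)]
        simpa using hc) (by rw [hge _ (by omega)]; simp) 0 (by omega)
      rw [hge _ (by omega)] at this
      simp at this
    refine ⟨⟨⟨_, hlast⟩, fun i r h1 h0 j hj => ?_⟩, hlast⟩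
    rcases Nat.eq_zero_or_pos r with rfl | hr
    · obtain rfl : j = 0 := by omega
      exact h0
    have hmod : ∀ k, periodicExt b (i + k) = periodicExt b (i % n + k) := fun k =>
      periodicExt_congr b (by simp)
    have him : i % n < n := Nat.mod_lt _ hn
    have hirn : i % n + r < n := by
      by_contra! hc
      have := h1 (n - 1 - i % n) (by omega)
      rw [hmod, show i % n + (n - 1 - i % n) = n - 1 by omega, hlast] at this
      simp at this
    have hz := h (i % n) r hr (fun j hj => by rw [hlt _ (by omega), ← hmod, h1 j hj])
      (by rw [hlt _ hirn, ← hmod, h0]; simp) j hj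
    have hjn : i % n + r + j < n := by
      by_contra! hc
      simp [hge _ hc] at hz
    rw [hlt _ hjn] at hz
    rw [Nat.add_assoc, hmod, ← Nat.add_assoc]
    simpa using hz

theorem circularly_and_last_iff {n : ℕ} [NeZero n] (b : Fin n → Bool) :
    (IsRunConstrainedCircularly b ∧ b 0 = true ∧ periodicExt b (n - 1) = false) ↔
      (acceptsBlocks false 0 (List.ofFn b) = true ∧ b 0 = true) := by
  rw [(acceptsBlocks_iff _).1, isRunConstrainedCircularly_iff]
  constructor
  · rintro ⟨h, hb, hl⟩
    exact ⟨⟨by simp, (runConstrained_periodicExt_iff b hb).1 ⟨h, hl⟩⟩, hb⟩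
  · rintro ⟨⟨-, h⟩, hb⟩
    have := (runConstrained_periodicExt_iff b hb).2 h
    exact ⟨this.1, hb, this.2⟩

/-! ### Run starts, run ends and isolated 1s -/

open scoped Classical in
theorem card_run_start (k : ℕ) :
    (Finset.univ.filter fun b : Fin (k + 3) → Bool =>
      IsRunConstrainedCircularly b ∧ b 0 = true ∧ periodicExt b (k + 3 - 1) = false).card =
      acceptedCount false 0 (k + 1) := by
  simp only [circularly_and_last_iff]
  rw [← acceptedCount_true_one, Finset.card_filter, sum_string_succ]
  simp [acceptsBlocks, acceptedCount]

open scoped Classical in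
theorem card_isolated_one (k : ℕ) :
    (Finset.univ.filter fun b : Fin (k + 3) → Bool =>
      (IsRunConstrainedCircularly b ∧ b 0 = true ∧ periodicExt b (k + 3 - 1) = false) ∧
        periodicExt b 1 = false).card = acceptedCount false 0 k := by
  have h1 : ∀ b : Fin (k + 3) → Bool, periodicExt b 1 = b 1 := fun b =>
    periodicExt_of_lt b (by omega)
  have hc : ∀ (a c : Bool) (b : Fin (k + 1) → Bool),
      (Fin.cons a (Fin.cons c b : Fin (k + 2) → Bool) : Fin (k + 3) → Bool) 1 = c :=
    fun _ _ _ => rfl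
  simp only [circularly_and_last_iff, h1]
  -- The prefix `10` leaves one more 0 owed, hence the state `(false, 1)` on `k + 1` letters.
  rw [← acceptedCount_false_succ, Finset.card_filter, sum_string_succ, sum_string_succ,
    sum_string_succ (n := k + 1)]
  simp [acceptsBlocks, acceptedCount, hc]

-- Complementary counts agree: rotating by one exchanges "1s at positions 0 and 1" with "1s at
-- positions `n - 1` and 0".
open scoped Classical in
theorem card_run_end {n : ℕ} [NeZero n] :
    (Finset.univ.filter fun b : Fin n → Bool =>
      IsRunConstrainedCircularly b ∧ b 0 = true ∧ periodicExt b 1 = false).card =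
    (Finset.univ.filter fun b : Fin n → Bool =>
      IsRunConstrainedCircularly b ∧ b 0 = true ∧ periodicExt b (n - 1) = false).card := by
  have hn : 0 < n := Nat.pos_of_ne_zero (NeZero.ne n)
  set A := Finset.univ.filter fun b : Fin n → Bool => IsRunConstrainedCircularly b ∧ b 0 = true
  have h1 := Finset.card_filter_add_card_filter_not (s := A) (fun b => periodicExt b 1 = false)
  have h2 := Finset.card_filter_add_card_filter_not (s := A)
    (fun b => periodicExt b (n - 1) = false)
  have h3 : (A.filter fun b => ¬ periodicExt b 1 = false).card =
      (A.filter fun b => ¬ periodicExt b (n - 1) = false).card := by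
    refine Finset.card_equiv (rotate (Fin.ofNat n 1)) fun b => ?_
    have e0 : rotate (Fin.ofNat n 1) b 0 = periodicExt b 1 := by
      simp [rotate_apply, periodicExt]
    have e1 : periodicExt (rotate (Fin.ofNat n 1) b) (n - 1) = b 0 := by
      rw [periodicExt_rotate, ← periodicExt_val b 0]
      apply periodicExt_congr
      simp [Fin.ofNat, Nat.sub_add_cancel hn]
    simp only [A, Finset.mem_filter, Finset.mem_univ, true_and, isRunConstrainedCircularly_rotate,
      e0, e1, Bool.not_eq_false]
    tauto
  simp only [A, Finset.filter_filter, and_assoc] at h1 h2 h3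
  omega

/-! ### Edges as removable 1s -/

/-- The positions of a run-constrained-circularly string whose bit 1 can be turned into 0. -/
def IsRemovable {n : ℕ} (b : Fin n → Bool) (i : Fin n) : Prop :=
  IsRunConstrainedCircularly b ∧ b i = true ∧
    IsRunConstrainedCircularly (Function.update b i false)

open scoped Classical in
theorem card_isRemovable_zero (k : ℕ) :
    (Finset.univ.filter fun b : Fin (k + 3) → Bool => IsRemovable b 0).card +
      acceptedCount false 0 k = 2 * acceptedCount false 0 (k + 1) := by
  have h : (Finset.univ.filter fun b : Fin (k + 3) → Bool => IsRemovable b 0) =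
      (Finset.univ.filter fun b : Fin (k + 3) → Bool =>
        IsRunConstrainedCircularly b ∧ b 0 = true ∧ periodicExt b (k + 3 - 1) = false) ∪
      (Finset.univ.filter fun b : Fin (k + 3) → Bool =>
        IsRunConstrainedCircularly b ∧ b 0 = true ∧ periodicExt b 1 = false) := by
    ext b
    simp only [Finset.mem_filter, Finset.mem_univ, true_and, Finset.mem_union]
    rw [← and_or_left, ← and_or_left, IsRemovable]
    refine and_congr_right fun hb => and_congr_right fun hb0 => ?_
    exact circularly_clear_iff (by omega) hb hb0
  have hi : (Finset.univ.filter fun b : Fin (k + 3) → Bool =>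
        IsRunConstrainedCircularly b ∧ b 0 = true ∧ periodicExt b (k + 3 - 1) = false) ∩
      (Finset.univ.filter fun b : Fin (k + 3) → Bool =>
        IsRunConstrainedCircularly b ∧ b 0 = true ∧ periodicExt b 1 = false) =
      Finset.univ.filter fun b : Fin (k + 3) → Bool =>
        (IsRunConstrainedCircularly b ∧ b 0 = true ∧ periodicExt b (k + 3 - 1) = false) ∧
          periodicExt b 1 = false := by
    ext b
    simp only [Finset.mem_filter, Finset.mem_univ, true_and, Finset.mem_inter]
    tauto
  rw [h, ← card_isolated_one, ← hi, Finset.card_union_add_card_inter, card_run_end,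
    card_run_start]
  ring

theorem isRemovable_rotate {n : ℕ} [NeZero n] (b : Fin n → Bool) (i : Fin n) :
    IsRemovable (rotate i b) 0 ↔ IsRemovable b i := by
  have : Function.update (rotate i b) 0 false = rotate i (Function.update b i false) := by
    ext j
    simp [rotate_apply, Function.update_apply]
  rw [IsRemovable, IsRemovable, this, isRunConstrainedCircularly_rotate,
    isRunConstrainedCircularly_rotate, rotate_apply, zero_add]

open scoped Classical in
theorem card_isRemovable (n : ℕ) [NeZero n] :
    (Finset.univ.filter fun x : (Fin n → Bool) × Fin n => IsRemovable x.1 x.2).card =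
      n * (Finset.univ.filter fun b : Fin n → Bool => IsRemovable b 0).card := by
  rw [Finset.card_filter, Fintype.sum_prod_type_right]
  simp only [← Finset.card_filter]
  rw [Finset.sum_const_nat (m := (Finset.univ.filter fun b : Fin n → Bool => IsRemovable b 0).card)]
  · simp
  · intro i _
    exact Finset.card_equiv (rotate i) fun b => by simp [isRemovable_rotate]

theorem hammingDist_clear {n : ℕ} {b : Fin n → Bool} {i : Fin n} (h : b i = true) :
    hammingDist b (Function.update b i false) = 1 := by
  rw [hammingDist, Finset.card_eq_one]
  refine ⟨i, ?_⟩
  ext j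
  simp only [Finset.mem_filter, Finset.mem_univ, true_and, Finset.mem_singleton,
    Function.update_apply]
  split_ifs with hj
  · simp [hj, h]
  · simp [hj]

theorem eq_clear_of_hammingDist {n : ℕ} {u v : Fin n → Bool} (h : hammingDist u v = 1) :
    ∃ i, (u i = true ∧ v = Function.update u i false) ∨
      (v i = true ∧ u = Function.update v i false) := by
  rw [hammingDist, Finset.card_eq_one] at h
  obtain ⟨i, hi⟩ := h
  have hi' : ∀ j, u j ≠ v j ↔ j = i := fun j => by
    simpa using Finset.ext_iff.1 hi j
  have hne : ∀ j, j ≠ i → u j = v j := fun j hj => not_not.1 fun h => hj ((hi' j).1 h)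
  have hii := (hi' i).2 rfl
  refine ⟨i, ?_⟩
  cases hu : u i <;> cases hv : v i
  · simp [hu, hv] at hii
  · refine Or.inr ⟨rfl, funext fun j => ?_⟩
    rw [Function.update_apply]
    split_ifs with hj
    · rw [hj, hu]
    · exact hne j hj
  · refine Or.inl ⟨rfl, funext fun j => ?_⟩
    rw [Function.update_apply]
    split_ifs with hj
    · rw [hj, hv]
    · exact (hne j hj).symm
  · simp [hu, hv] at hii

theorem clear_injective {n : ℕ} {b : Fin n → Bool} {i j : Fin n} (hi : b i = true)
    (h : Function.update b i false = Function.update b j false) : i = j := by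
  by_contra hij
  have := congrFun h i
  simp [Function.update_of_ne hij, hi] at this

-- Each edge has a unique orientation, from the endpoint with the extra 1 to the other.
open scoped Classical in
theorem ncard_edgeSet_associatedMersenneGraph (n : ℕ) :
    (associatedMersenneGraph n).edgeSet.ncard =
      (Finset.univ.filter fun x : (Fin n → Bool) × Fin n => IsRemovable x.1 x.2).card := by
  rw [← Set.ncard_coe_finset]
  symm
  refine Set.ncard_congr (fun x hx => s(⟨x.1, by simp at hx; exact hx.1⟩,
    ⟨Function.update x.1 x.2 false, by simp at hx; exact hx.2.2⟩)) ?_ ?_ ?_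
  · rintro ⟨b, i⟩ hx
    simp at hx
    exact hammingDist_clear hx.2.1
  · rintro ⟨b, i⟩ ⟨c, j⟩ hx hy h
    simp at hx hy
    simp only [Sym2.eq_iff, Subtype.mk.injEq] at h
    rcases h with ⟨rfl, h⟩ | ⟨h1, h2⟩
    · rw [clear_injective hx.2.1 h]
    · exfalso
      have hc : c j = true := hy.2.1
      rw [← h2, Function.update_apply] at hc
      split_ifs at hc
      rw [h1] at hc
      simp at hc
  · intro e he
    induction e using Sym2.ind with
    | _ u v =>
      obtain ⟨u, hu⟩ := u
      obtain ⟨v, hv⟩ := v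
      obtain ⟨i, ⟨h1, rfl⟩ | ⟨h1, rfl⟩⟩ := eq_clear_of_hammingDist (show hammingDist u v = 1 from he)
      · exact ⟨(u, i), by simpa using ⟨hu, h1, hv⟩, rfl⟩
      · exact ⟨(v, i), by simpa using ⟨hv, h1, hu⟩, Sym2.eq_swap⟩

/-! ### Edge formula and generating function -/

theorem ncard_edgeSet_add (k : ℕ) :
    (associatedMersenneGraph (k + 3)).edgeSet.ncard + (k + 3) * acceptedCount false 0 k =
      2 * ((k + 3) * Nat.fib (k + 1)) := by
  classical
  rw [ncard_edgeSet_associatedMersenneGraph, card_isRemovable, ← Nat.mul_add,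
    card_isRemovable_zero, acceptedCount_eq_fib]
  ring

theorem ncard_edgeSet_three : (associatedMersenneGraph 3).edgeSet.ncard = 3 := by
  have := ncard_edgeSet_add 0
  simp [acceptedCount_false_zero] at this
  omega

theorem ncard_edgeSet_add_four (k : ℕ) :
    ((associatedMersenneGraph (k + 4)).edgeSet.ncard : ℚ) =
      (k + 4) * (Nat.fib k + Nat.fib (k + 2)) := by
  have := ncard_edgeSet_add (k + 1)
  rw [acceptedCount_eq_fib] at this
  have h2 := Nat.fib_add_two (n := k)
  have h3 : ((associatedMersenneGraph (k + 1 + 3)).edgeSet.ncard : ℚ) +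
      (k + 1 + 3) * Nat.fib (k + 1) = 2 * ((k + 1 + 3) * Nat.fib (k + 1 + 1)) := by
    exact_mod_cast this
  have h2' : (Nat.fib (k + 2) : ℚ) = Nat.fib k + Nat.fib (k + 1) := by exact_mod_cast h2
  rw [show k + 4 = k + 1 + 3 from rfl]
  rw [show k + 1 + 1 = k + 2 from rfl, h2'] at h3
  rw [h2']
  linear_combination h3

theorem corollary3p9 :
    (PowerSeries.mk (fun n : ℕ =>
        if 3 ≤ n then ((associatedMersenneGraph n).edgeSet.ncard : ℚ) else 0) : PowerSeries ℚ) =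
      (3 - 2 * PowerSeries.X + 4 * PowerSeries.X ^ 2 - 4 * PowerSeries.X ^ 3
          - 3 * PowerSeries.X ^ 4) * PowerSeries.X ^ 3 *
        ((1 - PowerSeries.X - PowerSeries.X ^ 2) ^ 2)⁻¹ := by
  rw [PowerSeries.eq_mul_inv_iff_mul_eq (by simp)]
  set e : ℕ → ℚ := fun n =>
    if 3 ≤ n then ((associatedMersenneGraph n).edgeSet.ncard : ℚ) else 0 with he
  have e3 : e 3 = 3 := by simp [he, ncard_edgeSet_three]
  have e4 : ∀ k, e (k + 4) = (k + 4) * (Nat.fib k + Nat.fib (k + 2)) := fun k => by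
    rw [← ncard_edgeSet_add_four]; simp [he]
  have e012 : e 0 = 0 ∧ e 1 = 0 ∧ e 2 = 0 := by simp [he]
  clear_value e
  obtain ⟨e0, e1, e2⟩ := e012
  have hl : PowerSeries.mk e * (1 - PowerSeries.X - PowerSeries.X ^ 2) ^ 2 =
      PowerSeries.mk e - PowerSeries.C 2 * (PowerSeries.mk e * PowerSeries.X ^ 1)
        - PowerSeries.mk e * PowerSeries.X ^ 2 + PowerSeries.C 2 * (PowerSeries.mk e * PowerSeries.X ^ 3)
        + PowerSeries.mk e * PowerSeries.X ^ 4 := by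
    simp only [map_ofNat]
    ring
  have hr : ((3 - 2 * PowerSeries.X + 4 * PowerSeries.X ^ 2 - 4 * PowerSeries.X ^ 3
      - 3 * PowerSeries.X ^ 4) * PowerSeries.X ^ 3 : PowerSeries ℚ) =
      PowerSeries.C 3 * PowerSeries.X ^ 3 - PowerSeries.C 2 * PowerSeries.X ^ 4
        + PowerSeries.C 4 * PowerSeries.X ^ 5 - PowerSeries.C 4 * PowerSeries.X ^ 6
        - PowerSeries.C 3 * PowerSeries.X ^ 7 := by
    simp only [map_ofNat]
    ring
  rw [hl, hr]
  ext n
  simp only [map_sub, map_add, PowerSeries.coeff_C_mul, PowerSeries.coeff_mul_X_pow',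
    PowerSeries.coeff_mk]
  have e4' := e4 0
  have e5 := e4 1
  have e6 := e4 2
  have e7 := e4 3
  norm_num [Nat.fib_add_two] at e4' e5 e6 e7
  -- The numerator has degree 7. From degree 8 on, all five indices `n - 4, …, n` are at least 4,
  -- where the closed formula holds.
  match n with
  | 0 | 1 | 2 | 3 | 4 | 5 | 6 | 7 => norm_num [e0, e1, e2, e3, e4', e5, e6, e7]
  | k + 8 =>
    have h8 := e4 (k + 4)
    have h7 := e4 (k + 3)
    have h6 := e4 (k + 2)
    have h5 := e4 (k + 1)
    have h4 := e4 k
    simp [Nat.fib_add_two, add_assoc] at h8 h7 h6 h5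
    simp [Nat.fib_add_two] at h4
    simp
    rw [h8, h7, h6, h5, h4]
    ring
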